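/- Let $M$ be a compact Hausdorff manifold (without boundary) with a foliation $\mathcal L$ of class $C^r$, $0\le r\le\infty$ or $r=\omega$, and leaves of any dimension and codimension; leaves carry the leaf topology. Let $L_0$ be a compact leaf, $\hat L_0\to L_0$ its universal cover, on which $\pi_1(L_0)$ acts by deck transformations. Let $T$ be a compact $C^r$ manifold, possibly with boundary, let $\rho:\pi_1(L_0)\to \mathrm{Diff}^r(T)$ be a homomorphism, and let $\pi_1(L_0)$ act on $\hat L_0\times T$ by $\gamma\cdot(x,t)=(\gamma x,\rho(\gamma)t)$. Suppose that on a neighbourhood $V$ of $L_0$ in $M$ the foliation $\mathcal L$ is the suspension of $\rho$, that is, there is a homeomorphism $\Phi:(\hat L_0\times T)/\pi_1(L_0)\to V$ which identifies the suspension foliation (whose leaves are the images of the sets $\hat L_0\times\{t\}$) with $\mathcal L|_V$: it is also a homeomorphism for the leaf topologies, and $V$ is open in the leaf topology of $M$. Then the group $\rho(\pi_1(L_0))$ is finitely generated, and the growth of every leaf $L_1$ of $\mathcal L$ through a point of $V$ is bounded by the growth of $\rho(\pi_1(L_0))$. Explicitly, let $S$ be a finite set of generators of $\rho(\pi_1(L_0))$,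 and let $g_S(n)$ be the number of elements that are products of at most $n$ elements of $S\cup S^{-1}$. Let $(U_i)_{i\in I}$ be a finite good cover of $M$ by foliated charts: the $U_i$ cover $M$, and for each $i$ some foliated chart of $\mathcal L$, with domain containing the closure of $U_i$, maps $U_i$ onto a product $A_i\times B_i$ of open sets with $A_i$ connected, where the plaques are the sets $A_i\times\{y\}$. The plaques of $L_1$ are the connected components of the sets $U_i\cap L_1$ in the leaf topology. For a plaque $P$ of $L_1$ let $\gamma_P(n)$ be the number of plaques $Q$ of $L_1$ for which there are $k<n$ and plaques $P=P_0,P_1,\dots,P_k=Q$ of $L_1$ with $P_j\cap P_{j+1}\neq\emptyset$ for $0\le j<k$. Then for every leaf $L_1$ of $\mathcal L$ through a point of $V$ and every plaque $P$ of $L_1$ there are constants $a,b\in\mathbb N$ such that $$\gamma_P(n)\le a\,g_S(bn)\qquad\text{for all } n\in\mathbb N .$$ -/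

import Mathlib

open Set Topology Manifold

/-- The local model of a foliation with leaves of dimension `p` and codimension `q`: the product
`ℝᵖ × ℝ^q`, foliated by the slices `ℝᵖ × {y}`. -/
abbrev FolModel (p q : ℕ) : Type :=
  EuclideanSpace ℝ (Fin p) × EuclideanSpace ℝ (Fin q)

/-- Maps of class `C^r` between open sets of `ℝᵖ × ℝ^q` which have locally the form
`(x, y) ↦ (f (x, y), g y)`. -/
def foliationPregroupoid (r : WithTop ℕ∞) (p q : ℕ) : Pregroupoid (FolModel p q) where
  property f s := ContDiffOn ℝ r f s ∧
    ∀ z ∈ s, ∃ N ∈ 𝓝 z, ∀ a ∈ N ∩ s, ∀ b ∈ N ∩ s, a.2 = b.2 → (f a).2 = (f b).2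
  comp := by
    rintro f g u v ⟨hf, hf'⟩ ⟨hg, hg'⟩ hu hv huv
    refine ⟨hg.comp (hf.mono inter_subset_left) inter_subset_right, ?_⟩
    rintro z ⟨hzu, hzv⟩
    obtain ⟨N, hN, h1⟩ := hf' z hzu
    obtain ⟨N', hN', h2⟩ := hg' (f z) hzv
    have hc : ContinuousAt f z := hf.continuousOn.continuousAt (hu.mem_nhds hzu)
    refine ⟨N ∩ f ⁻¹' N', Filter.inter_mem hN (hc hN'), ?_⟩
    rintro a ⟨⟨ha1, ha2⟩, ha3, ha4⟩ b ⟨⟨hb1, hb2⟩, hb3, hb4⟩ hab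
    exact h2 _ ⟨ha2, ha4⟩ _ ⟨hb2, hb4⟩ (h1 a ⟨ha1, ha3⟩ b ⟨hb1, hb3⟩ hab)
  id_mem := ⟨contDiff_id.contDiffOn, fun _ _ => ⟨univ, Filter.univ_mem, fun _ _ _ _ h => h⟩⟩
  locality := by
    intro f u hu h
    refine ⟨contDiffOn_of_locally_contDiffOn fun x hx => ?_, fun z hz => ?_⟩
    · obtain ⟨v, hv, hxv, hf⟩ := h x hx
      exact ⟨v, hv, hxv, hf.1⟩
    · obtain ⟨v, hv, hzv, hf⟩ := h z hz
      obtain ⟨N, hN, h1⟩ := hf.2 z ⟨hz, hzv⟩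
      refine ⟨N ∩ v, Filter.inter_mem hN (hv.mem_nhds hzv), ?_⟩
      rintro a ⟨⟨ha1, ha2⟩, ha3⟩ b ⟨⟨hb1, hb2⟩, hb3⟩ hab
      exact h1 a ⟨ha1, ha3, ha2⟩ b ⟨hb1, hb3, hb2⟩ hab
  congr := by
    rintro f g u hu hfg ⟨hf, hf'⟩
    refine ⟨hf.congr hfg, fun z hz => ?_⟩
    obtain ⟨N, hN, h1⟩ := hf' z hz
    refine ⟨N, hN, fun a ha b hb hab => ?_⟩
    rw [hfg a ha.2, hfg b hb.2]
    exact h1 a ha b hb hab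

/-- The groupoid of local transformations of class `C^r` of `ℝᵖ × ℝ^q` which preserve the foliation
by the slices `ℝᵖ × {y}`. A manifold with a foliation of class `C^r`, of leaf dimension `p` and
codimension `q`, is a charted space over `ℝᵖ × ℝ^q` whose changes of charts lie in this
groupoid. -/
def foliationGroupoid (r : WithTop ℕ∞) (p q : ℕ) : StructureGroupoid (FolModel p q) :=
  (foliationPregroupoid r p q).groupoid

section Foliation

variable (r : WithTop ℕ∞) (p q : ℕ) {M : Type*} [TopologicalSpace M] [ChartedSpace (FolModel p q) M]

variable (M) in
/-- The foliated charts of a foliated manifold. -/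
def foliatedCharts : Set (OpenPartialHomeomorph M (FolModel p q)) :=
  (foliationGroupoid r p q).maximalAtlas M

variable (M) in
/-- The leaf topology: a set is open when its trace on every slice `ℝᵖ × {y}` of every foliated
chart is open in that slice. -/
@[reducible] def leafTopology : TopologicalSpace M where
  IsOpen U := ∀ φ ∈ foliatedCharts r p q M, ∀ y : EuclideanSpace ℝ (Fin q),
    IsOpen {x : EuclideanSpace ℝ (Fin p) | (x, y) ∈ φ.target ∧ φ.symm (x, y) ∈ U}
  isOpen_univ := by
    intro φ _ y
    have h : Continuous fun x : EuclideanSpace ℝ (Fin p) => (x, y) := by fun_prop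
    convert φ.open_target.preimage h using 1
    ext x
    exact and_iff_left (mem_univ _)
  isOpen_inter := by
    intro U V hU hV φ hφ y
    convert (hU φ hφ y).inter (hV φ hφ y) using 1
    ext x
    simp only [mem_ofPred_eq, mem_inter_iff]
    tauto
  isOpen_sUnion := by
    intro S hS φ hφ y
    have h : {x : EuclideanSpace ℝ (Fin p) | (x, y) ∈ φ.target ∧ φ.symm (x, y) ∈ ⋃₀ S} =
        ⋃ U ∈ S, {x | (x, y) ∈ φ.target ∧ φ.symm (x, y) ∈ U} := by
      ext x
      simp only [mem_ofPred_eq, mem_sUnion, mem_iUnion]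
      tauto
    rw [h]
    exact isOpen_biUnion fun U hU => hS U hU φ hφ y

/-- The leaf through `z`, as a subset of `M`: the path component of `z` in the leaf topology. -/
def leafSet (z : M) : Set M := {w | @Joined M (leafTopology r p q M) z w}

/-- The leaf through `z`, as a space with the leaf topology. -/
def Leaf (z : M) : Type _ := {w : M // w ∈ leafSet r p q z}

instance (z : M) : TopologicalSpace (Leaf r p q z) :=
  (leafTopology r p q M).induced Subtype.val

/-- The point `z` of the leaf through `z`. -/
def Leaf.base (z : M) : Leaf r p q z := ⟨z, @Joined.refl M (leafTopology r p q M) z⟩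

/-- A good cover by foliated charts: open sets `U i` which cover `M`, such that the closure of
`U i` lies in the domain of a foliated chart, and that chart maps `U i` onto a product `A × B` of
open sets with `A` connected. The foliation is then simple on `U i`, with the sets `A × {y}` for
plaques. -/
def IsGoodFoliatedCover {ι : Type*} (U : ι → Set M) : Prop :=
  (⋃ i, U i = univ) ∧
  ∀ i, ∃ φ ∈ foliatedCharts r p q M,
    ∃ (A : Set (EuclideanSpace ℝ (Fin p))) (B : Set (EuclideanSpace ℝ (Fin q))),
      IsOpen A ∧ IsPreconnected A ∧ IsOpen B ∧
      closure (U i) ⊆ φ.source ∧ A ×ˢ B ⊆ φ.target ∧ U i = φ.symm '' (A ×ˢ B)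

/-- The plaques of the leaf through `z` relative to the cover `U`: the connected components of the
intersections of the leaf with the sets `U i`, for the leaf topology. -/
def plaques {ι : Type*} (U : ι → Set M) (z : M) : Set (Set M) :=
  {P | ∃ i, ∃ w ∈ U i ∩ leafSet r p q z,
    P = @connectedComponentIn M (leafTopology r p q M) (U i ∩ leafSet r p q z) w}

/-- The growth function of the leaf through `z` relative to the cover `U`, counted from the plaque
`P`: the number of plaques `Q` that are joined to `P` by a path `P = c 0, c 1, …, c k = Q` of
plaques of the leaf with `c j ∩ c (j + 1) ≠ ∅`, of length `k < n`. -/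
noncomputable def leafGrowth {ι : Type*} (U : ι → Set M) (z : M) (P : Set M) (n : ℕ) : ℕ∞ :=
  {Q : Set M | ∃ k < n, ∃ c : ℕ → Set M, c 0 = P ∧ c k = Q ∧
    (∀ j ≤ k, c j ∈ plaques r p q U z) ∧ ∀ j < k, (c j ∩ c (j + 1)).Nonempty}.encard

end Foliation

/-- The growth function of a group relative to a set `S` of generators: the number of elements that
are products of at most `n` elements of `S ∪ S⁻¹`. -/
noncomputable def groupGrowth {G : Type*} [Group G] (S : Set G) (n : ℕ) : ℕ∞ :=
  {g : G | ∃ l : List G, l.length ≤ n ∧ (∀ s ∈ l, s ∈ S ∨ s⁻¹ ∈ S) ∧ l.prod = g}.encard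

/-- The growth of `f` is bounded by the growth of `g`: there are constants `a`, `b` with
`f n ≤ a * g (b * n)` for all `n`. -/
def GrowthBoundedBy (f g : ℕ → ℕ∞) : Prop :=
  ∃ a b : ℕ, ∀ n : ℕ, f n ≤ (a : ℕ∞) * g (b * n)

/-- The group of deck transformations of a map `π`. -/
def deckGroup {X Y : Type*} [TopologicalSpace X] (π : X → Y) : Subgroup (X ≃ₜ X) where
  carrier := {h | ∀ x, π (h x) = π x}
  mul_mem' := by
    intro a b ha hb x
    exact (ha (b x)).trans (hb x)
  one_mem' := fun _ => rfl
  inv_mem' := by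
    intro a ha x
    have h := ha (a.symm x)
    rw [a.apply_symm_apply] at h
    exact h.symm

/-- The group `Diff^r(T)` of diffeomorphisms of class `C^r` of a manifold `T`, possibly with
boundary. -/
def diffGroup (r : WithTop ℕ∞) {E H : Type*} [NormedAddCommGroup E] [NormedSpace ℝ E]
    [TopologicalSpace H] (I : ModelWithCorners ℝ E H) (T : Type*) [TopologicalSpace T]
    [ChartedSpace H T] : Subgroup (T ≃ₜ T) where
  carrier := {h | ContMDiff I I r h ∧ ContMDiff I I r h.symm}
  mul_mem' := by
    rintro a b ⟨ha, ha'⟩ ⟨hb, hb'⟩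
    exact ⟨ha.comp hb, hb'.comp ha'⟩
  one_mem' := ⟨contMDiff_id, contMDiff_id⟩
  inv_mem' := by
    rintro a ⟨ha, ha'⟩
    exact ⟨ha', ha⟩

section Suspension

variable {G X T : Type*} [Group G] [TopologicalSpace X] [TopologicalSpace T]

/-- The orbit relation of the action `g (x, t) = (θ g x, ρ g t)` of `G` on `X × T`. -/
def suspensionSetoid (θ : G →* (X ≃ₜ X)) (ρ : G →* (T ≃ₜ T)) : Setoid (X × T) where
  r a b := ∃ g : G, θ g a.1 = b.1 ∧ ρ g a.2 = b.2
  iseqv :=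
    { refl := fun a => ⟨1, by simp, by simp⟩
      symm := by
        rintro a b ⟨g, h1, h2⟩
        refine ⟨g⁻¹, ?_, ?_⟩
        · rw [map_inv, ← h1]
          exact (θ g).symm_apply_apply a.1
        · rw [map_inv, ← h2]
          exact (ρ g).symm_apply_apply a.2
      trans := by
        rintro a b c ⟨g, h1, h2⟩ ⟨k, h3, h4⟩
        refine ⟨k * g, ?_, ?_⟩
        · rw [map_mul, ← h3, ← h1]
          rfl
        · rw [map_mul, ← h4, ← h2]
          rfl }

/-- The total space of the suspension: the quotient of `X × T` by the diagonal action of `G`. -/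
def Suspension (θ : G →* (X ≃ₜ X)) (ρ : G →* (T ≃ₜ T)) : Type _ :=
  Quotient (suspensionSetoid θ ρ)

/-- The topology of the suspension: the quotient topology. -/
@[reducible] def suspensionTopology (θ : G →* (X ≃ₜ X)) (ρ : G →* (T ≃ₜ T)) :
    TopologicalSpace (Suspension θ ρ) :=
  TopologicalSpace.coinduced (Quotient.mk (suspensionSetoid θ ρ)) instTopologicalSpaceProd

/-- The leaf topology of the suspension foliation, whose leaves are the images of the sets
`X × {t}`: the quotient of the topology of `X × T` in which `T` is discrete. -/
@[reducible] def suspensionLeafTopology (θ : G →* (X ≃ₜ X)) (ρ : G →* (T ≃ₜ T)) :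
    TopologicalSpace (Suspension θ ρ) :=
  TopologicalSpace.coinduced (Quotient.mk (suspensionSetoid θ ρ))
    (@instTopologicalSpaceProd X T _ ⊥)

end Suspension

/-- `Φ` identifies the suspension foliation with the restriction of the foliation of `M` to
`V`: it is a homeomorphism onto `V`, and also a homeomorphism of the leaf topologies onto `V`,
which is open for the leaf topology of `M` (the leaves of the suspension go to the leaves in
`V`). -/
structure IsFoliatedIso (r : WithTop ℕ∞) (p q : ℕ) {M G X T : Type*} [TopologicalSpace M]
    [ChartedSpace (FolModel p q) M] [Group G] [TopologicalSpace X] [TopologicalSpace T]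
    (θ : G →* (X ≃ₜ X)) (ρ : G →* (T ≃ₜ T)) (Φ : Suspension θ ρ → M) (V : Set M) : Prop where
  range_eq : range Φ = V
  isEmbedding : @IsEmbedding _ M (suspensionTopology θ ρ) _ Φ
  isOpenEmbedding_leaf :
    @IsOpenEmbedding _ M (suspensionLeafTopology θ ρ) (leafTopology r p q M) Φ

/-! The deck translates of some compact `K ⊆ X` cover `X`, so `V` is the image of the compact set `K
× T`. Hence `V` is clopen in the leaf topology, and a leaf through a point of `V` stays in `V`.
Writing a point of `V` as the image of `(k, s)` with `k ∈ K` gives it a coordinate `s ∈ T`, unique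
up to finitely many deck transformations.

Along one plaque the coordinate changes by an element of the image of `ρ` of word length at most
`b`, uniformly over all plaques in `V` (`IsSuspensionMap.exists_orbitRel_of_plaque`). Locally this
is proper discontinuity (`IsSuspensionMap.exists_box`); compactness and connectedness of the slices
make it global (`IsPreconnected.rel_of_finite_cover`). So a chain of `k` steps from a plaque with
coordinate `s₀` ends in a plaque with a coordinate `γ s₀`, where `γ` has length at most `b k`.

Conversely the coordinate almost determines the plaque: finitely many neighbourhoods cover `K × T`,
and in each of them the points with a given `s` meet at most one plaque of a given leaf in a given
`U i` (`IsSuspensionMap.exists_nhds_plaque_eq`). Thus the plaques are counted by the word ball times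
a finite set. Finite generation comes from cocompactness (`IsCocompactDeckAction.group_fg`). -/

/-! ### Word balls -/

section WordBall

variable {G : Type*} [Group G]

/-- The products of at most `n` elements of `S ∪ S⁻¹`. -/
def wordBall (S : Set G) (n : ℕ) : Set G :=
  {g : G | ∃ l : List G, l.length ≤ n ∧ (∀ s ∈ l, s ∈ S ∨ s⁻¹ ∈ S) ∧ l.prod = g}

theorem groupGrowth_eq (S : Set G) (n : ℕ) : groupGrowth S n = (wordBall S n).encard := rfl

theorem one_mem_wordBall (S : Set G) (n : ℕ) : (1 : G) ∈ wordBall S n :=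
  ⟨[], by simp, by simp, rfl⟩

theorem wordBall_mono (S : Set G) {m n : ℕ} (h : m ≤ n) : wordBall S m ⊆ wordBall S n := by
  rintro g ⟨l, h1, h2, h3⟩
  exact ⟨l, h1.trans h, h2, h3⟩

theorem mul_mem_wordBall {S : Set G} {m n : ℕ} {g h : G} (hg : g ∈ wordBall S m)
    (hh : h ∈ wordBall S n) : g * h ∈ wordBall S (m + n) := by
  obtain ⟨l, h1, h2, rfl⟩ := hg
  obtain ⟨l', h1', h2', rfl⟩ := hh
  refine ⟨l ++ l', by simp; omega, fun s hs => ?_, by simp⟩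
  rcases List.mem_append.1 hs with h | h
  exacts [h2 s h, h2' s h]

theorem inv_mem_wordBall {S : Set G} {m : ℕ} {g : G} (hg : g ∈ wordBall S m) :
    g⁻¹ ∈ wordBall S m := by
  obtain ⟨l, h1, h2, rfl⟩ := hg
  refine ⟨(l.map (·⁻¹)).reverse, by simpa using h1, fun s hs => ?_, by
    rw [List.prod_inv_reverse]⟩
  rcases h2 s⁻¹ (by simpa using hs) with h | h
  · exact Or.inr h
  · exact Or.inl (by simpa using h)

theorem exists_mem_wordBall {S : Set G} (hS : Subgroup.closure S = ⊤) (g : G) :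
    ∃ n, g ∈ wordBall S n := by
  have hg : g ∈ Subgroup.closure S := hS ▸ Subgroup.mem_top g
  induction hg using Subgroup.closure_induction with
  | mem x hx => exact ⟨1, [x], by simp, by simpa using Or.inl hx, by simp⟩
  | one => exact ⟨0, one_mem_wordBall S 0⟩
  | mul x y _ _ hx hy =>
    obtain ⟨m, hm⟩ := hx
    obtain ⟨n, hn⟩ := hy
    exact ⟨m + n, mul_mem_wordBall hm hn⟩
  | inv x _ hx =>
    obtain ⟨m, hm⟩ := hx
    exact ⟨m, inv_mem_wordBall hm⟩

theorem Set.Finite.exists_subset_wordBall {S : Set G} (hS : Subgroup.closure S = ⊤) {F : Set G}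
    (hF : F.Finite) : ∃ n, F ⊆ wordBall S n := by
  choose f hf using exists_mem_wordBall hS
  obtain ⟨n, hn⟩ := (hF.image f).bddAbove
  exact ⟨n, fun g hg => wordBall_mono S (hn (mem_image_of_mem f hg)) (hf g)⟩

end WordBall

/-- Distances along a preconnected set are bounded when it is covered by finitely many open sets
along which they are bounded. Here `R n s t` says that `s` and `t` have distance at most `n`. -/
theorem IsPreconnected.rel_of_finite_cover {Y T J : Type*} [TopologicalSpace Y] [Fintype J]
    {A : Set Y} (hA : IsPreconnected A) {O : J → Set Y} (hO : ∀ j, IsOpen (O j))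
    (hAO : A ⊆ ⋃ j, O j) {τ : Y → Set T} (hτ : ∀ x ∈ A, (τ x).Nonempty)
    {R : ℕ → T → T → Prop} (hmono : ∀ ⦃m n s t⦄, m ≤ n → R m s t → R n s t)
    (hR : ∀ ⦃m n s t u⦄, R m s t → R n t u → R (m + n) s u) (b : ℕ)
    (h : ∀ j, ∀ x ∈ A ∩ O j, ∀ x' ∈ A ∩ O j, ∀ s ∈ τ x, ∀ s' ∈ τ x', R b s s')
    {x x' : Y} (hx : x ∈ A) (hx' : x' ∈ A) {s s' : T} (hs : s ∈ τ x) (hs' : s' ∈ τ x') :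
    R (b * Fintype.card J) s s' := by
  classical
  -- The nerve of the cover of `A`; connectedness of `A` makes any two members that meet `A`
  -- reachable from each other.
  let Γ : SimpleGraph J :=
    { Adj := fun j k => j ≠ k ∧ (A ∩ (O j ∩ O k)).Nonempty
      symm := ⟨fun j k hjk => ⟨hjk.1.symm, by rw [inter_comm (O k)]; exact hjk.2⟩⟩
      loopless := ⟨fun j hj => hj.1 rfl⟩ }
  have hwalk : ∀ {j k : J} (w : Γ.Walk j k), ∀ x ∈ A ∩ O j, ∀ x' ∈ A ∩ O k,
      ∀ s ∈ τ x, ∀ s' ∈ τ x', R (b * (w.length + 1)) s s' := by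
    intro j k w
    induction w with
    | nil => simpa using h _
    | cons hjk w ih =>
      intro x hx x' hx' s hs s' hs'
      obtain ⟨-, y, hyA, hyj, hyk⟩ := hjk
      obtain ⟨u, hu⟩ := hτ y hyA
      refine hmono (le_of_eq ?_)
        (hR (h _ x hx y ⟨hyA, hyj⟩ s hs u hu) (ih y ⟨hyA, hyk⟩ x' hx' u hu s' hs'))
      rw [SimpleGraph.Walk.length_cons]
      ring
  obtain ⟨j, hj⟩ := mem_iUnion.1 (hAO hx)
  obtain ⟨k, hk⟩ := mem_iUnion.1 (hAO hx')
  have hreach : Γ.Reachable j k := by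
    by_contra hn
    obtain ⟨y, hyA, hy1, hy2⟩ := hA (⋃ i ∈ {i | Γ.Reachable j i}, O i)
      (⋃ i ∈ {i | ¬ Γ.Reachable j i}, O i) (isOpen_biUnion fun i _ => hO i)
      (isOpen_biUnion fun i _ => hO i)
      (fun y hy => by
        obtain ⟨i, hi⟩ := mem_iUnion.1 (hAO hy)
        by_cases hr : Γ.Reachable j i
        · exact Or.inl (mem_biUnion (show i ∈ {i | Γ.Reachable j i} from hr) hi)
        · exact Or.inr (mem_biUnion (show i ∈ {i | ¬ Γ.Reachable j i} from hr) hi))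
      ⟨x, hx, mem_biUnion (show j ∈ {i | Γ.Reachable j i} from .refl _) hj⟩
      ⟨x', hx', mem_biUnion (show k ∈ {i | ¬ Γ.Reachable j i} from hn) hk⟩
    obtain ⟨i, hi, hyi⟩ := mem_iUnion₂.1 hy1
    obtain ⟨i', hi', hyi'⟩ := mem_iUnion₂.1 hy2
    refine hi' (SimpleGraph.Reachable.trans hi (SimpleGraph.Adj.reachable ⟨?_, y, hyA, hyi, hyi'⟩))
    rintro rfl
    exact hi' hi
  -- A path repeats no vertex, so it visits at most `Fintype.card J` sets, each of which costs `b`.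
  obtain ⟨w, hw⟩ := hreach.exists_isPath
  exact hmono (Nat.mul_le_mul_left b hw.length_lt) (hwalk w x ⟨hx, hj⟩ x' ⟨hx', hk⟩ s hs s' hs')

/-! ### Cocompact properly discontinuous actions -/

section DeckAction

variable {G X : Type*} [Group G] [TopologicalSpace X]

/-- The action `θ` is free and properly discontinuous, and the translates of the compact set `K`
cover the space. -/
structure IsCocompactDeckAction (θ : G →* (X ≃ₜ X)) (K : Set X) : Prop where
  isCompact : IsCompact K
  exists_mem : ∀ x, ∃ g, θ g x ∈ K
  exists_free : ∀ x, ∃ W, IsOpen W ∧ x ∈ W ∧ ∀ g, ∀ w ∈ W, θ g w ∈ W → g = 1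
  exists_proper : ∀ x, ∃ W, IsOpen W ∧ x ∈ W ∧ {g | ∃ w ∈ W, θ g w ∈ K}.Finite

/-- For a suitable open `D ⊇ K`, the finitely many `g` with `g D` meeting `K` generate: otherwise
the points brought into `D` by the subgroup `L` they generate, and those brought into `D` by
elements outside `L`, would form a separation of the connected space. -/
theorem IsCocompactDeckAction.group_fg [ConnectedSpace X] {θ : G →* (X ≃ₜ X)} {K : Set X}
    (h : IsCocompactDeckAction θ K) : Group.FG G := by
  obtain ⟨D, hD, hKD, hfin⟩ : ∃ D, IsOpen D ∧ K ⊆ D ∧ {g | ∃ w ∈ D, θ g w ∈ K}.Finite := by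
    refine h.isCompact.induction_on
      (p := fun s => ∃ D, IsOpen D ∧ s ⊆ D ∧ {g | ∃ w ∈ D, θ g w ∈ K}.Finite) ?_ ?_ ?_ ?_
    · exact ⟨∅, isOpen_empty, subset_rfl, by simp⟩
    · rintro s t hst ⟨D, h1, h2, h3⟩
      exact ⟨D, h1, hst.trans h2, h3⟩
    · rintro s t ⟨D, h1, h2, h3⟩ ⟨D', h1', h2', h3'⟩
      refine ⟨D ∪ D', h1.union h1', union_subset_union h2 h2', (h3.union h3').subset ?_⟩
      rintro g ⟨w, hw | hw, hg⟩
      exacts [Or.inl ⟨w, hw, hg⟩, Or.inr ⟨w, hw, hg⟩]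
    · intro x _
      obtain ⟨W, hW, hx, hf⟩ := h.exists_proper x
      exact ⟨W, mem_nhdsWithin_of_mem_nhds (hW.mem_nhds hx), W, hW, subset_rfl, hf⟩
  set F := {g | ∃ w ∈ D, θ g w ∈ K}
  refine Group.fg_iff.2 ⟨F, ?_, hfin⟩
  set L := Subgroup.closure F
  have hmul : ∀ (g k : G) (x : X), θ g (θ k x) = θ (g * k) x := fun g k x => by
    rw [map_mul]; rfl
  have hF : ∀ (g k : G) (x : X), θ g x ∈ D → θ k x ∈ K → k * g⁻¹ ∈ L := fun g k x hg hk =>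
    Subgroup.subset_closure ⟨θ g x, hg, by rwa [hmul, inv_mul_cancel_right]⟩
  rw [Subgroup.eq_top_iff']
  by_contra! hne
  obtain ⟨g₀, hg₀⟩ := hne
  have hopen : ∀ P : G → Prop, IsOpen {x | ∃ g, P g ∧ θ g x ∈ D} := fun P => by
    have : {x | ∃ g, P g ∧ θ g x ∈ D} = ⋃ g ∈ {g | P g}, θ g ⁻¹' D := by
      ext x; simp
    rw [this]
    exact isOpen_biUnion fun g _ => hD.preimage (θ g).continuous
  obtain ⟨x₀⟩ : Nonempty X := inferInstance
  obtain ⟨k₀, hk₀⟩ := h.exists_mem x₀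
  obtain ⟨x, -, ⟨g, hg, hgx⟩, ⟨g', hg', hgx'⟩⟩ := (isPreconnected_univ (α := X)) _ _
    (hopen (· ∈ L)) (hopen (· ∉ L))
    (fun x _ => by
      obtain ⟨k, hk⟩ := h.exists_mem x
      by_cases hkL : k ∈ L
      · exact Or.inl ⟨k, hkL, hKD hk⟩
      · exact Or.inr ⟨k, hkL, hKD hk⟩)
    ⟨θ k₀ x₀, trivial, 1, one_mem _, by simpa using hKD hk₀⟩
    ⟨θ (g₀⁻¹ * k₀) x₀, trivial, g₀, hg₀, by rw [hmul, mul_inv_cancel_left]; exact hKD hk₀⟩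
  -- Both `k g⁻¹` and `k g'⁻¹` lie in `L`, so `g ∈ L` forces `g' ∈ L`.
  obtain ⟨k, hk⟩ := h.exists_mem x
  have h1 := hF g k x hgx hk
  have h2 := hF g' k x hgx' hk
  have hkL : k ∈ L := by simpa using L.mul_mem h1 hg
  exact hg' (by simpa using L.mul_mem (L.inv_mem h2) hkL)

end DeckAction

/-! ### Deck transformations of the universal cover -/

section Covering

variable {X B : Type*} [TopologicalSpace X] [TopologicalSpace B] {π : X → B}

/-- The charts given by a local homeomorphism. -/
@[reducible] noncomputable def IsLocalHomeomorph.pullbackChartedSpace (h : IsLocalHomeomorph π) :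
    ChartedSpace B X where
  atlas := univ
  chartAt x := (h x).choose
  mem_chart_source x := (h x).choose_spec.1
  chart_mem_atlas _ := trivial

theorem IsCoveringMap.surjective [PathConnectedSpace B] [Nonempty X] (hπ : IsCoveringMap π) :
    Function.Surjective π := by
  intro b
  obtain ⟨x⟩ := ‹Nonempty X›
  let γ : Path (π x) b := PathConnectedSpace.somePath _ _
  obtain ⟨Γ, hΓ, -⟩ := hπ.exists_path_lifts γ x (by simp)
  exact ⟨Γ 1, by simpa using congrFun hΓ 1⟩

/-- Lift `π` through itself with `x ↦ y` and with `y ↦ x`; by uniqueness of lifts the two maps are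
mutually inverse. -/
theorem IsCoveringMap.exists_deckGroup_apply_eq [SimplyConnectedSpace X]
    [LocallyPathConnectedSpace X] (hπ : IsCoveringMap π) {x y : X} (hxy : π x = π y) :
    ∃ h ∈ deckGroup π, h x = y := by
  obtain ⟨f, ⟨hf, hπf⟩, -⟩ := hπ.existsUnique_continuousMap_lifts
    ⟨π, hπ.continuous⟩ x y hxy.symm
  obtain ⟨g, ⟨hg, hπg⟩, -⟩ := hπ.existsUnique_continuousMap_lifts
    ⟨π, hπ.continuous⟩ y x hxy
  have hπf' : ∀ z, π (f z) = π z := fun z => congrFun hπf z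
  have hπg' : ∀ z, π (g z) = π z := fun z => congrFun hπg z
  have h1 : (g ∘ f : X → X) = id := hπ.eq_of_comp_eq (g.continuous.comp f.continuous)
    continuous_id (by ext z; simp [hπf', hπg']) x (by simp [hf, hg])
  have h2 : (f ∘ g : X → X) = id := hπ.eq_of_comp_eq (f.continuous.comp g.continuous)
    continuous_id (by ext z; simp [hπf', hπg']) y (by simp [hf, hg])
  exact ⟨⟨⟨f, g, congrFun h1, congrFun h2⟩, f.continuous, g.continuous⟩, hπf', hf⟩

theorem IsCoveringMap.exists_isCocompactDeckAction {G : Type*} [Group G] [SimplyConnectedSpace X]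
    [T2Space B] [CompactSpace B] [LocallyCompactSpace B] [PathConnectedSpace B]
    [LocallyPathConnectedSpace B]
    (hπ : IsCoveringMap π) (θ : G ≃* deckGroup π) :
    ∃ K, IsCocompactDeckAction ((deckGroup π).subtype.comp θ.toMonoidHom) K := by
  let _ := hπ.isLocalHomeomorph.pullbackChartedSpace
  have : LocallyPathConnectedSpace X := ChartedSpace.locallyPathConnectedSpace B X
  have : LocallyCompactSpace X := ChartedSpace.locallyCompactSpace B X
  set θ' := (deckGroup π).subtype.comp θ.toMonoidHom with hθ'
  have hπθ : ∀ g x, π (θ' g x) = π x := fun g x => (θ g).2 x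
  have htrans : ∀ x y, π x = π y → ∃ g, θ' g x = y := fun x y hxy => by
    obtain ⟨h, hh, hx⟩ := hπ.exists_deckGroup_apply_eq hxy
    refine ⟨θ.symm ⟨h, hh⟩, ?_⟩
    rw [hθ']
    simpa using hx
  have hmul : ∀ (g k : G) (x : X), θ' g (θ' k x) = θ' (g * k) x := fun g k x => by
    rw [map_mul]; rfl
  have hfree : ∀ x, ∃ W, IsOpen W ∧ x ∈ W ∧ ∀ g, ∀ w ∈ W, θ' g w ∈ W → g = 1 := fun x => by
    obtain ⟨e, hxe, he⟩ := hπ.isLocalHomeomorph x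
    refine ⟨e.source, e.open_source, hxe, fun g w hw hgw => ?_⟩
    -- `π` is injective on the source of `e`, so `g` fixes `w`, and a deck transformation with a
    -- fixed point is the identity.
    have hfix : θ' g w = w := e.injOn hgw hw (by rw [← he]; exact hπθ g w)
    have hid : (θ' g : X → X) = id := hπ.eq_of_comp_eq (θ' g).continuous continuous_id
      (by ext z; simp [hπθ]) w hfix
    have : θ g = 1 := Subtype.ext (Homeomorph.ext fun z => congrFun hid z)
    simpa using this
  choose N hNc hN using fun x : X => exists_compact_mem_nhds x
  obtain ⟨t, ht⟩ := (isCompact_univ (X := B)).elim_nhds_subcover'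
    (fun b _ => π '' N (Function.surjInv hπ.surjective b)) fun b _ => by
      have := hπ.isOpenMap.image_mem_nhds (hN (Function.surjInv hπ.surjective b))
      rwa [Function.surjInv_eq hπ.surjective] at this
  -- Finitely many compact neighbourhoods upstairs whose images cover the base; transitivity on
  -- fibres moves every point into their union.
  let K := ⋃ b ∈ t, N (Function.surjInv hπ.surjective b)
  have hK : IsCompact K := t.isCompact_biUnion fun b _ => hNc _
  refine ⟨K, hK, fun x => ?_, hfree, fun x => ?_⟩
  · obtain ⟨b, hb, k, hk, hkx⟩ := mem_iUnion₂.1 (ht (mem_univ (π x)))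
    obtain ⟨g, hg⟩ := htrans x k hkx.symm
    exact ⟨g, hg ▸ mem_biUnion hb hk⟩
  · refine hK.induction_on
      (p := fun s => ∃ W, IsOpen W ∧ x ∈ W ∧ {g | ∃ w ∈ W, θ' g w ∈ s}.Finite) ?_ ?_ ?_ ?_
    · exact ⟨univ, isOpen_univ, trivial, by simp⟩
    · rintro s t hst ⟨W, h1, h2, h3⟩
      exact ⟨W, h1, h2, h3.subset fun g ⟨w, hw, hg⟩ => ⟨w, hw, hst hg⟩⟩
    · rintro s t ⟨W, h1, h2, h3⟩ ⟨W', h1', h2', h3'⟩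
      refine ⟨W ∩ W', h1.inter h1', ⟨h2, h2'⟩, (h3.union h3').subset ?_⟩
      rintro g ⟨w, hw, hg | hg⟩
      exacts [Or.inl ⟨w, hw.1, hg⟩, Or.inr ⟨w, hw.2, hg⟩]
    · intro k _
      -- If `k = h x`, freeness near `x` leaves only the element `h`; in different fibres, disjoint
      -- neighbourhoods in the base leave none.
      by_cases hxk : π x = π k
      · obtain ⟨h, rfl⟩ := htrans x k hxk
        obtain ⟨W, hW, hxW, hWf⟩ := hfree x
        refine ⟨θ' h⁻¹ ⁻¹' W, mem_nhdsWithin_of_mem_nhds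
          ((hW.preimage (θ' h⁻¹).continuous).mem_nhds ?_), W, hW, hxW,
          (finite_singleton h).subset ?_⟩
        · rw [mem_preimage, hmul, inv_mul_cancel, map_one]
          exact hxW
        · rintro g ⟨w, hw, hg⟩
          rw [mem_preimage, hmul] at hg
          exact (inv_mul_eq_one.1 (hWf _ w hw hg)).symm
      · obtain ⟨u, v, hu, hv, hxu, hkv, huv⟩ := t2_separation hxk
        refine ⟨π ⁻¹' v, mem_nhdsWithin_of_mem_nhds ((hv.preimage hπ.continuous).mem_nhds hkv),
          π ⁻¹' u, hu.preimage hπ.continuous, hxu, ?_⟩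
        convert finite_empty
        ext g
        simp only [mem_ofPred_eq, mem_empty_iff_false, iff_false]
        rintro ⟨w, hw, hg⟩
        rw [mem_preimage, hπθ] at hg
        exact huv.le_bot ⟨hw, hg⟩

end Covering

theorem IsPreconnected.subset_of_disjoint_open {Y Z : Type*} [TopologicalSpace Y] {C : Set Y}
    (hC : IsPreconnected C) {O : Z → Set Y} (hO : ∀ z, IsOpen (O z))
    (hd : Pairwise (Function.onFun Disjoint O)) (hCO : C ⊆ ⋃ z, O z) {w : Y} (hw : w ∈ C) {z : Z}
    (hwz : w ∈ O z) : C ⊆ O z := by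
  refine hC.subset_left_of_subset_union (v := ⋃ z' ∈ ({z}ᶜ : Set Z), O z') (hO z)
    (isOpen_biUnion fun z' _ => hO z') ?_ ?_ ⟨w, hw, hwz⟩
  · rw [disjoint_iUnion₂_right]
    exact fun z' hz' => hd (Ne.symm hz')
  · intro y hy
    obtain ⟨z', hz'⟩ := mem_iUnion.1 (hCO hy)
    by_cases h : z' = z
    · exact Or.inl (h ▸ hz')
    · exact Or.inr (mem_biUnion h hz')

/-! ### The leaf topology and plaques as slices -/

section LeafSpace

/-- A foliated manifold with the leaf topology. -/
def LeafSpace (_r : WithTop ℕ∞) (_p _q : ℕ) (M : Type*) : Type _ := M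

variable (r : WithTop ℕ∞) (p q : ℕ) (M : Type*) [TopologicalSpace M]
  [ChartedSpace (FolModel p q) M]

variable {M} in
/-- A point of a foliated manifold, as a point of the leaf space. -/
def toLeafSpace (w : M) : LeafSpace r p q M := w

instance : TopologicalSpace (LeafSpace r p q M) := leafTopology r p q M

variable {r p q M} {φ : OpenPartialHomeomorph M (FolModel p q)}

theorem continuousOn_slice (hφ : φ ∈ foliatedCharts r p q M) (y : EuclideanSpace ℝ (Fin q)) :
    ContinuousOn (fun x => toLeafSpace r p q (φ.symm (x, y))) {x | (x, y) ∈ φ.target} :=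
  (continuousOn_open_iff (φ.open_target.preimage (by fun_prop : Continuous fun x => (x, y)))).2
    fun _ ht => ht φ hφ y

/-- Changes of foliated charts locally send slices into slices, so the trace on any slice of another
chart is open. -/
theorem isOpen_leafSpace_slice (hφ : φ ∈ foliatedCharts r p q M) (y : EuclideanSpace ℝ (Fin q)) :
    IsOpen {w : LeafSpace r p q M | w ∈ φ.source ∧ (φ w).2 = y} := by
  intro ψ hψ y'
  rw [isOpen_iff_mem_nhds]
  rintro x ⟨hxt, hxs, hxy⟩
  have he : ψ.symm.trans φ ∈ foliationGroupoid r p q :=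
    StructureGroupoid.compatible_of_mem_maximalAtlas hψ hφ
  have hsource : ∀ x, (x, y') ∈ (ψ.symm.trans φ).source ↔
      (x, y') ∈ ψ.target ∧ ψ.symm (x, y') ∈ φ.source := fun x => by
    rw [OpenPartialHomeomorph.trans_source]
    rfl
  have hxe := (hsource x).2 ⟨hxt, hxs⟩
  obtain ⟨N, hN, h⟩ := (mem_groupoid_of_pregroupoid.1 he).1.2 (x, y') hxe
  have hc : ContinuousAt (fun x : EuclideanSpace ℝ (Fin p) => (x, y')) x := by fun_prop
  filter_upwards [hc (Filter.inter_mem hN ((ψ.symm.trans φ).open_source.mem_nhds hxe))]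
    with x' hx'
  have hx'' := (hsource x').1 hx'.2
  exact ⟨hx''.1, hx''.2, (h _ hx' _ ⟨mem_of_mem_nhds hN, hxe⟩ rfl).trans hxy⟩

variable (r p q M) in
theorem continuous_of_leafSpace : @Continuous (LeafSpace r p q M) M _ _ id := by
  refine ⟨fun U hU φ _ y => ?_⟩
  have hc : Continuous fun x : EuclideanSpace ℝ (Fin p) => (x, y) := by fun_prop
  exact (φ.isOpen_inter_preimage_symm hU).preimage hc

/-- The first component of a foliated chart, as a chart of the leaf space defined on a slice. -/
noncomputable def sliceChart (hφ : φ ∈ foliatedCharts r p q M) (y : EuclideanSpace ℝ (Fin q)) :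
    OpenPartialHomeomorph (LeafSpace r p q M) (EuclideanSpace ℝ (Fin p)) where
  toFun w := (φ w).1
  invFun x := toLeafSpace r p q (φ.symm (x, y))
  source := {w | w ∈ φ.source ∧ (φ w).2 = y}
  target := {x | (x, y) ∈ φ.target}
  map_source' := by
    rintro w ⟨hw, rfl⟩
    exact φ.map_source hw
  map_target' x hx := ⟨φ.map_target hx, congrArg Prod.snd (φ.right_inv hx)⟩
  left_inv' := by
    rintro w ⟨hw, rfl⟩
    exact φ.left_inv hw
  right_inv' _ hx := congrArg Prod.fst (φ.right_inv hx)
  open_source := isOpen_leafSpace_slice hφ y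
  open_target := φ.open_target.preimage (by fun_prop : Continuous fun x => (x, y))
  continuousOn_toFun := continuous_fst.comp_continuousOn
    (φ.continuousOn.comp (continuous_of_leafSpace r p q M).continuousOn fun _ hw => hw.1)
  continuousOn_invFun := continuousOn_slice hφ y

/-- The points of a preconnected subset of the leaf space in the domain of a foliated chart lie in
a single slice. -/
theorem IsPreconnected.snd_chart_eq (hφ : φ ∈ foliatedCharts r p q M)
    {C : Set (LeafSpace r p q M)} (hC : IsPreconnected C) (hCφ : ∀ w ∈ C, w ∈ φ.source)
    {w w' : M} (hw : w ∈ C) (hw' : w' ∈ C) : (φ w').2 = (φ w).2 := by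
  refine (hC.subset_of_disjoint_open (O := fun y => {w | w ∈ φ.source ∧ (φ w).2 = y})
    (fun y => isOpen_leafSpace_slice hφ y) ?_ ?_ hw ⟨hCφ w hw, rfl⟩ hw').2
  · intro y y' hy
    exact disjoint_left.2 fun w h h' => hy (h.2.symm.trans h'.2)
  · exact fun w hw => mem_iUnion.2 ⟨_, hCφ w hw, rfl⟩

/-- A plaque of a leaf in a distinguished open set is a slice. -/
theorem eq_slice_of_connectedComponentIn (hφ : φ ∈ foliatedCharts r p q M)
    {A : Set (EuclideanSpace ℝ (Fin p))} {B : Set (EuclideanSpace ℝ (Fin q))} (hA : IsOpen A)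
    (hA' : IsPreconnected A) (hAB : A ×ˢ B ⊆ φ.target) {U : Set M} (hU : U = φ.symm '' (A ×ˢ B))
    {z v w : M} (hv : v ∈ U ∩ leafSet r p q z)
    (hw : w ∈ @connectedComponentIn M (leafTopology r p q M) (U ∩ leafSet r p q z) v) :
    (φ w).2 ∈ B ∧ @connectedComponentIn M (leafTopology r p q M) (U ∩ leafSet r p q z) v =
      (fun x => φ.symm (x, (φ w).2)) '' A := by
  have hUmem : ∀ u, u ∈ U ↔ u ∈ φ.source ∧ φ u ∈ A ×ˢ B := by
    intro u
    rw [hU]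
    constructor
    · rintro ⟨a, ha, rfl⟩
      exact ⟨φ.map_target (hAB ha), by rwa [φ.right_inv (hAB ha)]⟩
    · rintro ⟨h1, h2⟩
      exact ⟨φ u, h2, φ.left_inv h1⟩
  let F : Set M := U ∩ leafSet r p q z
  let P : Set (LeafSpace r p q M) := @connectedComponentIn M (leafTopology r p q M) F v
  have hPpre : IsPreconnected P :=
    @isPreconnected_connectedComponentIn M (leafTopology r p q M) v F
  have hPsub : P ⊆ F :=
    @connectedComponentIn_subset M (leafTopology r p q M) F v
  have hvP : v ∈ P :=
    @mem_connectedComponentIn M (leafTopology r p q M) v _ hv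
  have hwU := (hUmem w).1 (hPsub hw).1
  have hconst : ∀ u ∈ P, (φ u).2 = (φ w).2 := fun u hu =>
    hPpre.snd_chart_eq hφ (fun u hu => ((hUmem u).1 (hPsub hu).1).1) hw hu
  refine ⟨hwU.2.2, Subset.antisymm (fun u hu => ?_) ?_⟩
  · have huU := (hUmem u).1 (hPsub hu).1
    exact ⟨(φ u).1, huU.2.1, by simp only [← hconst u hu, Prod.mk.eta]; exact φ.left_inv huU.1⟩
  -- Conversely, the whole slice is path connected in the leaf topology, so it stays in the leaf and
  -- in the component of `v`.
  · have hApc : IsPathConnected A :=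
      hA.isConnected_iff_isPathConnected.1 ⟨⟨_, hwU.2.1⟩, hA'⟩
    have hSpc : IsPathConnected
        ((fun x => toLeafSpace r p q (φ.symm (x, (φ w).2))) '' A) :=
      hApc.image' ((continuousOn_slice hφ _).mono fun x hx => hAB ⟨hx, hwU.2.2⟩)
    have hvS : v ∈ (fun x => toLeafSpace r p q (φ.symm (x, (φ w).2))) '' A := by
      have hvU := (hUmem v).1 hv.1
      exact ⟨(φ v).1, hvU.2.1, by
        simp only [← hconst v hvP, Prod.mk.eta]; exact φ.left_inv hvU.1⟩
    refine IsPreconnected.subset_connectedComponentIn (α := LeafSpace r p q M)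
      hSpc.isConnected.isPreconnected hvS fun u hu => ⟨?_, ?_⟩
    · obtain ⟨x, hx, rfl⟩ := hu
      rw [hU]
      exact ⟨(x, (φ w).2), ⟨hx, hwU.2.2⟩, rfl⟩
    · exact Joined.trans (X := LeafSpace r p q M) hv.2 (hSpc.joinedIn v hvS u hu).joined

variable (r p q) in
theorem Leaf.isEmbedding (z : M) :
    IsEmbedding (fun w : Leaf r p q z => toLeafSpace r p q w.1) :=
  ⟨⟨rfl⟩, Subtype.val_injective⟩

instance [T2Space M] : T2Space (LeafSpace r p q M) :=
  T2Space.of_injective_continuous (Y := M) Function.injective_id (continuous_of_leafSpace r p q M)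

instance [T2Space M] (z : M) : T2Space (Leaf r p q z) :=
  (Leaf.isEmbedding r p q z).t2Space

instance (z : M) : PathConnectedSpace (Leaf r p q z) :=
  have h : PathConnectedSpace (pathComponent (toLeafSpace r p q z)) :=
    isPathConnected_iff_pathConnectedSpace.1 isPathConnected_pathComponent
  h

variable [HasGroupoid M (foliationGroupoid r p q)]

noncomputable instance : ChartedSpace (EuclideanSpace ℝ (Fin p)) (LeafSpace r p q M) where
  atlas := univ
  chartAt w := sliceChart
    (StructureGroupoid.chart_mem_maximalAtlas (foliationGroupoid r p q) (M := M) w)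
    (chartAt (FolModel p q) (M := M) w w).2
  mem_chart_source w := ⟨mem_chart_source (FolModel p q) (M := M) w, rfl⟩
  chart_mem_atlas _ := trivial

instance : LocallyPathConnectedSpace (LeafSpace r p q M) :=
  ChartedSpace.locallyPathConnectedSpace (EuclideanSpace ℝ (Fin p)) _

instance : LocallyCompactSpace (LeafSpace r p q M) :=
  ChartedSpace.locallyCompactSpace (EuclideanSpace ℝ (Fin p)) _

variable (r p q) in
theorem Leaf.isOpenEmbedding (z : M) :
    IsOpenEmbedding (fun w : Leaf r p q z => toLeafSpace r p q w.1) := by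
  refine ⟨Leaf.isEmbedding r p q z, ?_⟩
  have : range (fun w : Leaf r p q z => toLeafSpace r p q w.1) =
      pathComponent (X := LeafSpace r p q M) z := Subtype.range_coe
  rw [this]
  exact IsOpen.pathComponent _

instance (z : M) : LocallyPathConnectedSpace (Leaf r p q z) :=
  (Leaf.isOpenEmbedding r p q z).locallyPathConnectedSpace

instance (z : M) : LocallyCompactSpace (Leaf r p q z) :=
  (Leaf.isOpenEmbedding r p q z).locallyCompactSpace

end LeafSpace

/-- Counting by labels: an element may have several labels, but no label is shared, so any choice of
labels is injective. -/
theorem Set.encard_le_encard_of_rel {α β : Type*} {s : Set α} {t : Set β} (R : α → β → Prop)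
    (h : ∀ a ∈ s, ∃ b ∈ t, R a b)
    (hR : ∀ a ∈ s, ∀ a' ∈ s, ∀ b, R a b → R a' b → a = a') : s.encard ≤ t.encard := by
  choose f hft hf using h
  let e : s ↪ t := ⟨fun a => ⟨f a a.2, hft a a.2⟩, fun a a' h => by
    have hfa : f a a.2 = f a' a'.2 := congrArg Subtype.val h
    exact Subtype.ext (hR a a.2 a' a'.2 _ (hf a a.2) (hfa ▸ hf a' a'.2))⟩
  exact e.encard_le

/-! ### The suspension and its two topologies -/

section ProdDiscrete

variable {X Y T T' : Type*} [TopologicalSpace X] [TopologicalSpace Y]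

theorem Continuous.prodMap_bot {f : X → Y} (hf : Continuous f) (g : T → T') :
    @Continuous _ _ (@instTopologicalSpaceProd X T _ ⊥) (@instTopologicalSpaceProd Y T' _ ⊥)
      fun a => (f a.1, g a.2) := by
  let _ : TopologicalSpace T := ⊥
  let _ : TopologicalSpace T' := ⊥
  have : DiscreteTopology T := ⟨rfl⟩
  exact hf.prodMap continuous_of_discreteTopology

theorem IsOpen.prod_singleton_bot {W : Set X} (hW : IsOpen W) (s : T) :
    IsOpen[@instTopologicalSpaceProd X T _ ⊥] (W ×ˢ {s}) := by
  let _ : TopologicalSpace T := ⊥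
  have : DiscreteTopology T := ⟨rfl⟩
  exact hW.prod (isOpen_discrete {s})

theorem continuous_prodMk_bot (s : T) :
    @Continuous X (X × T) _ (@instTopologicalSpaceProd X T _ ⊥) fun x => (x, s) := by
  let _ : TopologicalSpace T := ⊥
  fun_prop

end ProdDiscrete

section Quotient

variable {G X T : Type*} [Group G] [TopologicalSpace X] [TopologicalSpace T]

/-- The quotient map onto the suspension. -/
def suspensionMk (θ : G →* (X ≃ₜ X)) (ρ : G →* (T ≃ₜ T)) : X × T → Suspension θ ρ :=
  Quotient.mk (suspensionSetoid θ ρ)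

/-- The saturation of `W` is the union of its translates. The topology `τ` is a parameter because
both the product topology and the one with `T` discrete are needed. -/
theorem isOpen_mk_image_suspension (θ : G →* (X ≃ₜ X)) (ρ : G →* (T ≃ₜ T))
    (τ : TopologicalSpace (X × T))
    (hτ : ∀ g, @Continuous _ _ τ τ fun a : X × T => (θ g a.1, ρ g a.2)) {W : Set (X × T)}
    (hW : IsOpen[τ] W) :
    IsOpen[τ.coinduced (suspensionMk θ ρ)]
      (suspensionMk θ ρ '' W) := by
  refine isOpen_coinduced.2 ?_
  have : suspensionMk θ ρ ⁻¹' (suspensionMk θ ρ '' W) =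
      ⋃ g, (fun a : X × T => (θ g a.1, ρ g a.2)) ⁻¹' W := by
    ext a
    simp only [mem_preimage, mem_image, mem_iUnion]
    constructor
    · rintro ⟨b, hb, hba⟩
      obtain ⟨g, h1, h2⟩ := (suspensionSetoid θ ρ).symm (Quotient.exact hba)
      exact ⟨g, by rw [h1, h2]; exact hb⟩
    · rintro ⟨g, hg⟩
      exact ⟨_, hg, Quotient.sound ((suspensionSetoid θ ρ).symm ⟨g, rfl, rfl⟩)⟩
  rw [this]
  exact isOpen_iUnion fun g => hW.preimage (hτ g)

end Quotient

/-- `Ψ` is the composition of the quotient map of the suspension with an isomorphism of the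
suspension foliation onto an open subset `V` of the leaf space. -/
structure IsSuspensionMap (r : WithTop ℕ∞) (p q : ℕ) {M G X T : Type*} [TopologicalSpace M]
    [ChartedSpace (FolModel p q) M] [Group G] [TopologicalSpace X] [TopologicalSpace T]
    (θ : G →* (X ≃ₜ X)) (ρ : G →* (T ≃ₜ T)) (Ψ : X × T → M) (V : Set M) : Prop where
  range_eq : range Ψ = V
  eq_iff : ∀ a b, Ψ a = Ψ b ↔ ∃ g, θ g a.1 = b.1 ∧ ρ g a.2 = b.2
  continuous : Continuous Ψ
  exists_isOpen : ∀ W, IsOpen W → ∃ O, IsOpen O ∧ Ψ '' W = O ∩ V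
  isOpen_leaf : ∀ s W, IsOpen W → IsOpen ((fun x => toLeafSpace r p q (Ψ (x, s))) '' W)
  continuous_leaf : ∀ s, Continuous fun x => toLeafSpace r p q (Ψ (x, s))

theorem IsFoliatedIso.isSuspensionMap {r : WithTop ℕ∞} {p q : ℕ} {M G X T : Type*}
    [TopologicalSpace M] [ChartedSpace (FolModel p q) M] [Group G] [TopologicalSpace X]
    [TopologicalSpace T] {θ : G →* (X ≃ₜ X)} {ρ : G →* (T ≃ₜ T)} {Φ : Suspension θ ρ → M}
    {V : Set M} (h : IsFoliatedIso r p q θ ρ Φ V) :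
    IsSuspensionMap r p q θ ρ (fun a => Φ (suspensionMk θ ρ a)) V where
  range_eq := by
    rw [← h.range_eq]
    exact Quotient.mk_surjective.range_comp Φ
  eq_iff a b := by
    have hΦ : Function.Injective Φ := by
      let _ := suspensionTopology θ ρ
      exact h.isEmbedding.injective
    refine hΦ.eq_iff.trans ?_
    exact Quotient.eq (r := suspensionSetoid θ ρ)
  continuous := by
    let _ := suspensionTopology θ ρ
    exact h.isEmbedding.continuous.comp continuous_coinduced_rng
  exists_isOpen W hW := by
    let _ := suspensionTopology θ ρ
    obtain ⟨O, hO, hOW⟩ := h.isEmbedding.isInducing.isOpen_iff.1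
      (isOpen_mk_image_suspension θ ρ _ (fun g => by fun_prop) hW)
    refine ⟨O, hO, ?_⟩
    rw [← h.range_eq, ← image_preimage_eq_inter_range, hOW, image_image]
  isOpen_leaf s W hW := by
    let _ := suspensionLeafTopology θ ρ
    have hleaf : IsOpenEmbedding (fun a => toLeafSpace r p q (Φ a)) := h.isOpenEmbedding_leaf
    have h1 := hleaf.isOpenMap _ (isOpen_mk_image_suspension θ ρ _
        (fun g => (θ g).continuous.prodMap_bot (ρ g)) (hW.prod_singleton_bot s))
    rw [image_image, prod_singleton, image_image] at h1
    exact h1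
  continuous_leaf s := by
    let τ := @instTopologicalSpaceProd X T _ ⊥
    let _ := suspensionLeafTopology θ ρ
    have h1 : @Continuous _ _ τ _ (suspensionMk θ ρ) := continuous_coinduced_rng
    have hleaf : IsOpenEmbedding (fun a => toLeafSpace r p q (Φ a)) := h.isOpenEmbedding_leaf
    exact hleaf.continuous.comp
      (@Continuous.comp _ _ _ _ τ _ _ _ h1 (continuous_prodMk_bot s))

theorem OpenPartialHomeomorph.exists_prod_subset {p q : ℕ} {M : Type*} [TopologicalSpace M]
    {φ : OpenPartialHomeomorph M (FolModel p q)} {z : M} (hz : z ∈ φ.source) {O : Set M}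
    (hO : IsOpen O) (hzO : z ∈ O) :
    ∃ (D : Set (EuclideanSpace ℝ (Fin p))) (E : Set (EuclideanSpace ℝ (Fin q))),
      IsOpen D ∧ IsPreconnected D ∧ IsOpen E ∧ φ z ∈ D ×ˢ E ∧
      ∀ x ∈ D, ∀ y ∈ E, (x, y) ∈ φ.target ∧ φ.symm (x, y) ∈ O := by
  have hnhds : φ.target ∩ φ.symm ⁻¹' O ∈ 𝓝 (φ z) :=
    (φ.isOpen_inter_preimage_symm hO).mem_nhds
      ⟨φ.map_source hz, by rw [mem_preimage, φ.left_inv hz]; exact hzO⟩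
  obtain ⟨ε, hε, hball⟩ := Metric.mem_nhds_iff.1 hnhds
  rw [← Prod.mk.eta (p := φ z), ← ball_prod_same] at hball
  exact ⟨Metric.ball (φ z).1 ε, Metric.ball (φ z).2 ε, Metric.isOpen_ball,
    (convex_ball _ _).isPreconnected, Metric.isOpen_ball,
    ⟨Metric.mem_ball_self hε, Metric.mem_ball_self hε⟩, fun x hx y hy => hball ⟨hx, hy⟩⟩

/-! ### Change of the transversal coordinate inside a foliated box -/

section Growth

variable {r : WithTop ℕ∞} {p q : ℕ} {M G Γ X T : Type*} [TopologicalSpace M]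
  [ChartedSpace (FolModel p q) M] [Group G] [Group Γ] [TopologicalSpace X] [TopologicalSpace T]
  {θ : G →* (X ≃ₜ X)} {ρ : G →* (T ≃ₜ T)} {Ψ : X × T → M} {V : Set M} {K : Set X}
  {φ : OpenPartialHomeomorph M (FolModel p q)}

/-- The points of `T` which are the second coordinates of the preimages of `w` in `K × T`. -/
def transversalPoints (Ψ : X × T → M) (K : Set X) (w : M) : Set T := {s | ∃ k ∈ K, Ψ (k, s) = w}

theorem IsSuspensionMap.transversalPoints_nonempty (h : IsSuspensionMap r p q θ ρ Ψ V)
    (hK : IsCocompactDeckAction θ K) {w : M} (hw : w ∈ V) :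
    (transversalPoints Ψ K w).Nonempty := by
  rw [← h.range_eq] at hw
  obtain ⟨⟨x, s⟩, rfl⟩ := hw
  obtain ⟨g, hg⟩ := hK.exists_mem x
  exact ⟨ρ g s, θ g x, hg, ((h.eq_iff _ _).2 ⟨g, rfl, rfl⟩).symm⟩

theorem IsSuspensionMap.isCompact [CompactSpace T] (h : IsSuspensionMap r p q θ ρ Ψ V)
    (hK : IsCocompactDeckAction θ K) : IsCompact V := by
  have : V = Ψ '' (K ×ˢ univ) := by
    refine Subset.antisymm (fun w hw => ?_) ?_
    · obtain ⟨s, k, hk, rfl⟩ := h.transversalPoints_nonempty hK hw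
      exact ⟨(k, s), ⟨hk, trivial⟩, rfl⟩
    · rw [← h.range_eq]
      exact image_subset_range _ _
  rw [this]
  exact (hK.isCompact.prod isCompact_univ).image h.continuous

/-- Closed because `V` is compact in the Hausdorff space `M` and the leaf topology is finer; open as
a union of images of the sheets `X × {s}`. -/
theorem IsSuspensionMap.isClopen [CompactSpace T] [T2Space M]
    (h : IsSuspensionMap r p q θ ρ Ψ V) (hK : IsCocompactDeckAction θ K) :
    IsClopen {w : LeafSpace r p q M | w ∈ V} := by
  refine ⟨(h.isCompact hK).isClosed.preimage (continuous_of_leafSpace r p q M), ?_⟩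
  have : {w : LeafSpace r p q M | w ∈ V} =
      ⋃ s, (fun x => toLeafSpace r p q (Ψ (x, s))) '' univ := by
    ext w
    simp only [mem_ofPred_eq, ← h.range_eq, mem_iUnion, image_univ]
    exact ⟨fun ⟨⟨x, s⟩, hw⟩ => ⟨s, x, hw⟩, fun ⟨s, x, hw⟩ => ⟨(x, s), hw⟩⟩
  rw [this]
  exact isOpen_iUnion fun s => h.isOpen_leaf s univ isOpen_univ

theorem IsSuspensionMap.slice_subset [CompactSpace T] [T2Space M]
    (h : IsSuspensionMap r p q θ ρ Ψ V) (hK : IsCocompactDeckAction θ K)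
    (hφ : φ ∈ foliatedCharts r p q M) {D : Set (EuclideanSpace ℝ (Fin p))}
    (hD : IsPreconnected D) {y : EuclideanSpace ℝ (Fin q)} (hDy : ∀ x ∈ D, (x, y) ∈ φ.target)
    {x x' : EuclideanSpace ℝ (Fin p)} (hx : x ∈ D) (hx' : x' ∈ D) (hV : φ.symm (x, y) ∈ V) :
    φ.symm (x', y) ∈ V :=
  (hD.image _ ((continuousOn_slice hφ y).mono hDy)).subset_isClopen (h.isClopen hK)
    ⟨_, mem_image_of_mem _ hx, hV⟩ (mem_image_of_mem _ hx')

/-- In a small box, a slice contained in `V` lifts to a single sheet `W × {t}`, and only finitely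
many deck transformations bring points of `W` into `K`. -/
theorem IsSuspensionMap.exists_box [CompactSpace T] [T2Space M]
    (h : IsSuspensionMap r p q θ ρ Ψ V) (hK : IsCocompactDeckAction θ K)
    (hφ : φ ∈ foliatedCharts r p q M) {z : M} (hz : z ∈ φ.source) (hzV : z ∈ V) :
    ∃ (D : Set (EuclideanSpace ℝ (Fin p))) (E : Set (EuclideanSpace ℝ (Fin q))),
      IsOpen D ∧ IsOpen E ∧ φ z ∈ D ×ˢ E ∧
      ∃ F : Set G, F.Finite ∧ ∀ y ∈ E, ∀ x ∈ D, ∀ x' ∈ D, φ.symm (x, y) ∈ V →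
        ∀ s ∈ transversalPoints Ψ K (φ.symm (x, y)),
        ∀ s' ∈ transversalPoints Ψ K (φ.symm (x', y)), ∃ g ∈ F, ρ g s = s' := by
  rw [← h.range_eq] at hzV
  obtain ⟨⟨x₀, s₀⟩, rfl⟩ := hzV
  obtain ⟨W₁, hW₁, hx₁, hfree⟩ := hK.exists_free x₀
  obtain ⟨W₂, hW₂, hx₂, hproper⟩ := hK.exists_proper x₀
  set W := W₁ ∩ W₂
  set F₀ := {g | ∃ w ∈ W₂, θ g w ∈ K}
  have hW : IsOpen W := hW₁.inter hW₂
  obtain ⟨O, hO, hWO⟩ := h.exists_isOpen (W ×ˢ univ) (hW.prod isOpen_univ)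
  have hzO : Ψ (x₀, s₀) ∈ O ∩ V := hWO.subset ⟨(x₀, s₀), ⟨⟨hx₁, hx₂⟩, trivial⟩, rfl⟩
  obtain ⟨D, E, hDo, hD, hE, hzDE, hDE⟩ :=
    OpenPartialHomeomorph.exists_prod_subset hz hO hzO.1
  -- `F₀` contains the elements that carry `t` to `s` and to `s'`; going back from `s` to `t` and on
  -- to `s'` gives a quotient of two of them.
  refine ⟨D, E, hDo, hE, hzDE, image2 (fun a b => a * b⁻¹) F₀ F₀, hproper.image2 _ hproper, ?_⟩
  intro y hy x hx x' hx' hxV s hs s' hs'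
  have hDV : ∀ u ∈ D, φ.symm (u, y) ∈ V := fun u hu =>
    h.slice_subset hK hφ hD (fun v hv => (hDE v hv y hy).1) hx hu hxV
  have hDW : ∀ u ∈ D, ∃ w ∈ W, ∃ t, Ψ (w, t) = φ.symm (u, y) := fun u hu => by
    obtain ⟨⟨w, t⟩, ⟨hw, -⟩, hwt⟩ := hWO.superset ⟨(hDE u hu y hy).2, hDV u hu⟩
    exact ⟨w, hw, t, hwt⟩
  obtain ⟨w, hw, t, hwt⟩ := hDW x hx
  have hsub : (fun u => toLeafSpace r p q (φ.symm (u, y))) '' D ⊆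
      (fun x => toLeafSpace r p q (Ψ (x, t))) '' W := by
    refine IsPreconnected.subset_of_disjoint_open
      (O := fun t => (fun x => toLeafSpace r p q (Ψ (x, t))) '' W)
      (hD.image _ ((continuousOn_slice hφ y).mono fun v hv => (hDE v hv y hy).1))
      (fun t => h.isOpen_leaf t W hW) ?_ ?_ (mem_image_of_mem _ hx) ⟨w, hw, hwt⟩
    -- Freeness on `W` makes the images of different sheets `W × {t}` disjoint, so the connected
    -- slice lies in one of them.
    · intro t t' htt
      refine disjoint_left.2 ?_
      rintro _ ⟨v, hv, rfl⟩ ⟨v', hv', hvv⟩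
      obtain ⟨g, h1, h2⟩ := (h.eq_iff (v, t) (v', t')).1 hvv.symm
      have hg : g = 1 := hfree g v hv.1 (by rw [show θ g v = v' from h1]; exact hv'.1)
      exact htt (by simpa [hg] using h2)
    · rintro _ ⟨u, hu, rfl⟩
      obtain ⟨w, hw, t, hwt⟩ := hDW u hu
      exact mem_iUnion.2 ⟨t, w, hw, hwt⟩
  obtain ⟨w', hw', hwt'⟩ := hsub (mem_image_of_mem _ hx')
  obtain ⟨k, hk, hks⟩ := hs
  obtain ⟨k', hk', hks'⟩ := hs'
  obtain ⟨g, h1, h2⟩ := (h.eq_iff _ _).1 (hwt.trans hks.symm)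
  obtain ⟨g', h1', h2'⟩ := (h.eq_iff _ _).1 (Eq.trans hwt' hks'.symm)
  refine ⟨g' * g⁻¹, mem_image2_of_mem ⟨w', hw'.2, ?_⟩ ⟨w, hw.2, ?_⟩, ?_⟩
  · rw [show θ g' w' = k' from h1']; exact hk'
  · rw [show θ g w = k from h1]; exact hk
  · rw [← show ρ g t = s from h2, ← show ρ g' t = s' from h2', map_mul, map_inv]
    exact congrArg (ρ g') ((ρ g).symm_apply_apply t)

end Growth

/-! ### Uniform bounds along plaques, and the count of plaques -/

section Growth

variable {r : WithTop ℕ∞} {p q : ℕ} {M G Γ X T : Type*} [TopologicalSpace M]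
  [ChartedSpace (FolModel p q) M] [Group G] [Group Γ] [TopologicalSpace X] [TopologicalSpace T]
  {θ : G →* (X ≃ₜ X)} {ρ : G →* (T ≃ₜ T)} {Ψ : X × T → M} {V : Set M} {K : Set X}
  {φ : OpenPartialHomeomorph M (FolModel p q)}

/-- The point `s'` is the image of `s` by a product of at most `n` elements of `S ∪ S⁻¹`. -/
def OrbitRel (α : Γ →* (T ≃ₜ T)) (S : Set Γ) (n : ℕ) (s s' : T) : Prop :=
  ∃ γ ∈ wordBall S n, α γ s = s'

theorem OrbitRel.mono {α : Γ →* (T ≃ₜ T)} {S : Set Γ} ⦃m n : ℕ⦄ ⦃s s' : T⦄ (h : m ≤ n)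
    (hs : OrbitRel α S m s s') : OrbitRel α S n s s' := by
  obtain ⟨γ, hγ, hs⟩ := hs
  exact ⟨γ, wordBall_mono S h hγ, hs⟩

theorem OrbitRel.trans {α : Γ →* (T ≃ₜ T)} {S : Set Γ} ⦃m n : ℕ⦄ ⦃s t u : T⦄
    (h : OrbitRel α S m s t) (h' : OrbitRel α S n t u) : OrbitRel α S (m + n) s u := by
  obtain ⟨γ, hγ, rfl⟩ := h
  obtain ⟨γ', hγ', rfl⟩ := h'
  refine ⟨γ' * γ, Nat.add_comm n m ▸ mul_mem_wordBall hγ' hγ, ?_⟩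
  rw [map_mul]
  rfl

variable {σ : G →* Γ} {α : Γ →* (T ≃ₜ T)}
  {S : Set Γ}

/-- The closure of the distinguished set lies in the chart domain and meets `V` in a compact set, so
finitely many boxes serve all slices at once; each connected slice is crossed by a path in the nerve
of these boxes. -/
theorem IsSuspensionMap.exists_orbitRel_of_slice [CompactSpace T] [T2Space M] [CompactSpace M]
    (h : IsSuspensionMap r p q θ (α.comp σ) Ψ V) (hK : IsCocompactDeckAction θ K)
    (hS : Subgroup.closure S = ⊤) (hφ : φ ∈ foliatedCharts r p q M)
    {A : Set (EuclideanSpace ℝ (Fin p))} {B : Set (EuclideanSpace ℝ (Fin q))}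
    (hA : IsPreconnected A) (hAB : A ×ˢ B ⊆ φ.target)
    (hcl : closure (φ.symm '' (A ×ˢ B)) ⊆ φ.source) :
    ∃ n, ∀ y ∈ B, ∀ x ∈ A, ∀ x' ∈ A, φ.symm (x, y) ∈ V →
      ∀ s ∈ transversalPoints Ψ K (φ.symm (x, y)),
      ∀ s' ∈ transversalPoints Ψ K (φ.symm (x', y)), OrbitRel α S n s s' := by
  have hbox : ∀ z ∈ closure (φ.symm '' (A ×ˢ B)) ∩ V,
      ∃ (D : Set (EuclideanSpace ℝ (Fin p))) (E : Set (EuclideanSpace ℝ (Fin q))),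
        IsOpen D ∧ IsOpen E ∧ φ z ∈ D ×ˢ E ∧ ∃ n, ∀ y ∈ E, ∀ x ∈ D, ∀ x' ∈ D,
          φ.symm (x, y) ∈ V → ∀ s ∈ transversalPoints Ψ K (φ.symm (x, y)),
          ∀ s' ∈ transversalPoints Ψ K (φ.symm (x', y)), OrbitRel α S n s s' := by
    rintro z ⟨hz, hzV⟩
    obtain ⟨D, E, hD, hE, hzDE, F, hF, hFs⟩ := h.exists_box hK hφ (hcl hz) hzV
    obtain ⟨n, hn⟩ := (hF.image σ).exists_subset_wordBall hS
    refine ⟨D, E, hD, hE, hzDE, n, fun y hy x hx x' hx' hV s hs s' hs' => ?_⟩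
    obtain ⟨g, hg, hgs⟩ := hFs y hy x hx x' hx' hV s hs s' hs'
    exact ⟨σ g, hn (mem_image_of_mem σ hg), hgs⟩
  choose! D E hD hE hzDE n hn using hbox
  have hcompact : IsCompact (closure (φ.symm '' (A ×ˢ B)) ∩ V) :=
    isClosed_closure.isCompact.inter_right (h.isCompact hK).isClosed
  obtain ⟨t, ht, hcover⟩ := hcompact.elim_nhds_subcover
    (fun z => φ.source ∩ φ ⁻¹' (D z ×ˢ E z)) fun z hz =>
      (φ.isOpen_inter_preimage ((hD z hz).prod (hE z hz))).mem_nhds ⟨hcl hz.1, hzDE z hz⟩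
  refine ⟨t.sup n * Fintype.card t, fun y hy x hx x' hx' hV s hs s' hs' => ?_⟩
  have hAV : ∀ u ∈ A, φ.symm (u, y) ∈ V := fun u hu =>
    h.slice_subset hK hφ hA (fun v hv => hAB ⟨hv, hy⟩) hx hu hV
  refine hA.rel_of_finite_cover (J := t) (O := fun z => {u | u ∈ D z ∧ y ∈ E z})
    (fun z => (hD z (ht z z.2)).and isOpen_const) ?_
    (τ := fun u => transversalPoints Ψ K (φ.symm (u, y)))
    (fun u hu => h.transversalPoints_nonempty hK (hAV u hu)) OrbitRel.mono OrbitRel.trans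
    (t.sup n) ?_ hx hx' hs hs'
  · intro u hu
    obtain ⟨z, hz, -, huz⟩ := mem_iUnion₂.1
      (hcover ⟨subset_closure ⟨(u, y), ⟨hu, hy⟩, rfl⟩, hAV u hu⟩)
    rw [mem_preimage, φ.right_inv (hAB ⟨hu, hy⟩)] at huz
    exact mem_iUnion.2 ⟨⟨z, hz⟩, huz⟩
  · rintro ⟨z, hz⟩ u ⟨huA, huD, hyE⟩ u' ⟨-, huD', -⟩ s hs s' hs'
    exact OrbitRel.mono (Finset.le_sup hz)
      (hn z (ht z hz) y hyE u huD u' huD' (hAV u huA) s hs s' hs')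

theorem IsSuspensionMap.plaque_subset [CompactSpace T] [T2Space M]
    (h : IsSuspensionMap r p q θ ρ Ψ V)
    (hK : IsCocompactDeckAction θ K) {ι : Type*} {U : ι → Set M} {z : M} (hz : z ∈ V) {Q : Set M}
    (hQ : Q ∈ plaques r p q U z) : Q ⊆ V := by
  obtain ⟨i, v, -, rfl⟩ := hQ
  intro w hw
  have hwz : w ∈ leafSet r p q z :=
    ((@connectedComponentIn_subset M (leafTopology r p q M) (U i ∩ leafSet r p q z) v) hw).2
  exact isPathConnected_pathComponent.isConnected.isPreconnected.subset_isClopen (h.isClopen hK)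
    ⟨toLeafSpace r p q z, mem_pathComponent_self _, hz⟩ hwz

theorem IsSuspensionMap.exists_orbitRel_of_plaque [CompactSpace T] [T2Space M] [CompactSpace M]
    (h : IsSuspensionMap r p q θ (α.comp σ) Ψ V) (hK : IsCocompactDeckAction θ K)
    (hS : Subgroup.closure S = ⊤) {ι : Type*} [Finite ι] {U : ι → Set M}
    (hU : IsGoodFoliatedCover r p q U) :
    ∃ n, ∀ z ∈ V, ∀ Q ∈ plaques r p q U z, ∀ w ∈ Q, ∀ w' ∈ Q,
      ∀ s ∈ transversalPoints Ψ K w, ∀ s' ∈ transversalPoints Ψ K w', OrbitRel α S n s s' := by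
  choose φ hφ A B hA hA' _ hcl hAB hUeq using hU.2
  have hi : ∀ i, ∃ n, ∀ y ∈ B i, ∀ x ∈ A i, ∀ x' ∈ A i, (φ i).symm (x, y) ∈ V →
      ∀ s ∈ transversalPoints Ψ K ((φ i).symm (x, y)),
      ∀ s' ∈ transversalPoints Ψ K ((φ i).symm (x', y)), OrbitRel α S n s s' := fun i =>
    h.exists_orbitRel_of_slice hK hS (hφ i) (hA' i) (hAB i) (hUeq i ▸ hcl i)
  choose n hn using hi
  obtain ⟨N, hN⟩ := (finite_range n).bddAbove
  refine ⟨N, fun z hz Q hQ w hw w' hw' s hs s' hs' => ?_⟩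
  have hwV := h.plaque_subset hK hz hQ hw
  obtain ⟨i, v, hv, rfl⟩ := hQ
  obtain ⟨hB, hQeq⟩ :=
    eq_slice_of_connectedComponentIn (hφ i) (hA i) (hA' i) (hAB i) (hUeq i) hv hw
  obtain ⟨x, hx, hxw⟩ := hQeq.subset hw
  obtain ⟨x', hx', hxw'⟩ := hQeq.subset hw'
  rw [← hxw] at hs hwV
  rw [← hxw'] at hs'
  exact OrbitRel.mono (hN (mem_range_self i)) (hn i _ hB x hx x' hx' hwV s hs s' hs')

/-- Near a point over `closure U`, a connected piece of a sheet stays in the chart domain, hence in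
one slice, and that slice determines the plaque. Away from `closure U` no plaque is met. -/
theorem IsSuspensionMap.exists_nhds_plaque_eq [LocallyConnectedSpace X]
    (h : IsSuspensionMap r p q θ ρ Ψ V) (hφ : φ ∈ foliatedCharts r p q M)
    {A : Set (EuclideanSpace ℝ (Fin p))} {B : Set (EuclideanSpace ℝ (Fin q))} (hA : IsOpen A)
    (hA' : IsPreconnected A) (hAB : A ×ˢ B ⊆ φ.target) {U : Set M} (hU : U = φ.symm '' (A ×ˢ B))
    (hcl : closure U ⊆ φ.source) (a : X × T) :
    ∃ N ∈ 𝓝 a, ∀ z, ∀ v ∈ U ∩ leafSet r p q z, ∀ v' ∈ U ∩ leafSet r p q z, ∀ s x x',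
      (x, s) ∈ N → (x', s) ∈ N →
      Ψ (x, s) ∈ @connectedComponentIn M (leafTopology r p q M) (U ∩ leafSet r p q z) v →
      Ψ (x', s) ∈ @connectedComponentIn M (leafTopology r p q M) (U ∩ leafSet r p q z) v' →
      @connectedComponentIn M (leafTopology r p q M) (U ∩ leafSet r p q z) v =
        @connectedComponentIn M (leafTopology r p q M) (U ∩ leafSet r p q z) v' := by
  by_cases ha : Ψ a ∈ closure U
  · have hnhds : Ψ ⁻¹' φ.source ∈ 𝓝 a :=
      (φ.open_source.preimage h.continuous).mem_nhds (hcl ha)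
    obtain ⟨W, hW, W', hW', hWW⟩ := mem_nhds_prod_iff.1 hnhds
    obtain ⟨C, hC, haC, hCc, hCW⟩ :=
      locallyConnectedSpace_iff_subsets_isOpen_isConnected.1 ‹_› a.1 W hW
    refine ⟨C ×ˢ W', prod_mem_nhds (haC.mem_nhds hCc) hW', ?_⟩
    rintro z v hv v' hv' s x x' ⟨hx, hs⟩ ⟨hx', -⟩ hQ hQ'
    have hy : (φ (Ψ (x', s))).2 = (φ (Ψ (x, s))).2 :=
      IsPreconnected.snd_chart_eq hφ
        (hCW.isPreconnected.image _ (h.continuous_leaf s).continuousOn)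
        (by rintro _ ⟨u, hu, rfl⟩; exact hWW ⟨hC hu, hs⟩)
        (mem_image_of_mem _ hx) (mem_image_of_mem _ hx')
    rw [(eq_slice_of_connectedComponentIn hφ hA hA' hAB hU hv hQ).2,
      (eq_slice_of_connectedComponentIn hφ hA hA' hAB hU hv' hQ').2, hy]
  · refine ⟨Ψ ⁻¹' (closure U)ᶜ,
      (isClosed_closure.isOpen_compl.preimage h.continuous).mem_nhds ha, ?_⟩
    intro z v _ v' _ s x x' hx _ hQ _
    exact absurd (subset_closure
      ((@connectedComponentIn_subset M (leafTopology r p q M) (U ∩ leafSet r p q z) v) hQ).1) hx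

theorem IsSuspensionMap.growthBoundedBy [CompactSpace T] [T2Space M] [CompactSpace M]
    [LocallyConnectedSpace X]
    (h : IsSuspensionMap r p q θ (α.comp σ) Ψ V) (hK : IsCocompactDeckAction θ K)
    (hS : Subgroup.closure S = ⊤) {ι : Type*} [Finite ι] {U : ι → Set M}
    (hU : IsGoodFoliatedCover r p q U) {z : M} (hz : z ∈ V) {P : Set M}
    (hP : P ∈ plaques r p q U z) :
    GrowthBoundedBy (leafGrowth r p q U z P) (groupGrowth S) := by
  obtain ⟨b, hb⟩ := h.exists_orbitRel_of_plaque hK hS hU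
  have hN : ∀ (a : X × T) i, ∃ N ∈ 𝓝 a, ∀ z, ∀ v ∈ U i ∩ leafSet r p q z,
      ∀ v' ∈ U i ∩ leafSet r p q z, ∀ s x x', (x, s) ∈ N → (x', s) ∈ N →
      Ψ (x, s) ∈ @connectedComponentIn M (leafTopology r p q M) (U i ∩ leafSet r p q z) v →
      Ψ (x', s) ∈ @connectedComponentIn M (leafTopology r p q M) (U i ∩ leafSet r p q z) v' →
      @connectedComponentIn M (leafTopology r p q M) (U i ∩ leafSet r p q z) v =
        @connectedComponentIn M (leafTopology r p q M) (U i ∩ leafSet r p q z) v' := by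
    intro a i
    obtain ⟨φ, hφ, A, B, hA, hA', -, hcl, hAB, hUeq⟩ := hU.2 i
    exact h.exists_nhds_plaque_eq hφ hA hA' hAB hUeq hcl a
  choose N hNa hN using hN
  obtain ⟨t, -, ht⟩ := (hK.isCompact.prod (isCompact_univ (X := T))).elim_nhds_subcover
    (fun a => ⋂ i, N a i) fun a _ => Filter.iInter_mem.2 (hNa a)
  have hPne : P.Nonempty := by
    obtain ⟨i, v, hv, rfl⟩ := hP
    exact ⟨v, @mem_connectedComponentIn M (leafTopology r p q M) v _ hv⟩
  obtain ⟨w₀, hw₀⟩ := hPne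
  obtain ⟨s₀, hs₀⟩ := h.transversalPoints_nonempty hK (h.plaque_subset hK hz hP hw₀)
  let J := ι × t
  have : Fintype J := Fintype.ofFinite J
  -- A plaque gets as label a group element, the index of its `U i`, and one of the neighbourhoods
  -- covering `K × T`.
  refine ⟨Fintype.card J, b, fun n => ?_⟩
  have hcard : (Fintype.card J : ℕ∞) * groupGrowth S (b * n) =
      (wordBall S (b * n) ×ˢ (univ : Set J)).encard := by
    rw [encard_prod, groupGrowth_eq, mul_comm, encard_univ, ENat.card_eq_coe_fintype_card]
  rw [hcard]
  refine encard_le_encard_of_rel (fun Q a => ∃ v ∈ U a.2.1 ∩ leafSet r p q z,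
    Q = @connectedComponentIn M (leafTopology r p q M) (U a.2.1 ∩ leafSet r p q z) v ∧
    ∃ x, (x, α a.1 s₀) ∈ N a.2.2 a.2.1 ∧ Ψ (x, α a.1 s₀) ∈ Q) ?_ ?_
  · rintro Q ⟨k, hk, c, rfl, rfl, hc, hcc⟩
    -- Each step crosses the plaque `c j` to a point shared with `c (j + 1)`, at cost at most `b`.
    have hchain : ∀ j ≤ k, ∃ w ∈ c j, ∃ s ∈ transversalPoints Ψ K w,
        OrbitRel α S (b * j) s₀ s := by
      intro j
      induction j with
      | zero => exact fun _ => ⟨w₀, hw₀, s₀, hs₀, 1, one_mem_wordBall S _, by simp⟩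
      | succ j ih =>
        intro hj
        obtain ⟨w, hw, s, hs, hR⟩ := ih (by omega)
        obtain ⟨w', hw', hw''⟩ := hcc j (by omega)
        have hcj := hc j (by omega)
        obtain ⟨s', hs'⟩ := h.transversalPoints_nonempty hK (h.plaque_subset hK hz hcj hw')
        exact ⟨w', hw'', s', hs', hR.trans (hb z hz _ hcj w hw w' hw' s hs s' hs')⟩
    obtain ⟨w, hw, s, ⟨x, hx, hxw⟩, hR⟩ := hchain k le_rfl
    obtain ⟨γ, hγ, rfl⟩ := OrbitRel.mono (Nat.mul_le_mul_left b hk.le) hR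
    obtain ⟨i, v, hv, hcv⟩ := hc k le_rfl
    obtain ⟨a, hat, ha⟩ := mem_iUnion₂.1 (ht (show (x, α γ s₀) ∈ K ×ˢ univ from ⟨hx, trivial⟩))
    exact ⟨(γ, i, ⟨a, hat⟩), ⟨hγ, trivial⟩, v, hv, hcv, x, mem_iInter.1 ha i, hxw ▸ hw⟩
  · rintro Q - Q' - ⟨γ, i, a⟩ ⟨v, hv, hQ, x, hx, hxQ⟩ ⟨v', hv', hQ', x', hx', hxQ'⟩
    rw [hQ] at hxQ
    rw [hQ'] at hxQ'
    rw [hQ, hQ']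
    exact hN a i z v hv v' hv' _ x x' hx hx' hxQ hxQ'

end Growth

theorem proposition2p1
    -- a compact manifold `M` with a foliation of class `C^r`
    (r : WithTop ℕ∞) (p q : ℕ)
    {M : Type*} [TopologicalSpace M] [T2Space M] [CompactSpace M]
    [ChartedSpace (FolModel p q) M] [HasGroupoid M (foliationGroupoid r p q)]
    -- a compact leaf, and its universal cover `X` with the deck action of the fundamental group
    (x₀ : M) [CompactSpace (Leaf r p q x₀)]
    {X : Type*} [TopologicalSpace X] [SimplyConnectedSpace X]
    (π : X → Leaf r p q x₀) (hπ : IsCoveringMap π)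
    (θ : FundamentalGroup (Leaf r p q x₀) (Leaf.base r p q x₀) ≃* deckGroup π)
    -- the compact transversal `T` and the representation in `Diff^r(T)`
    {E H : Type*} [NormedAddCommGroup E] [NormedSpace ℝ E] [TopologicalSpace H]
    (I : ModelWithCorners ℝ E H)
    {T : Type*} [TopologicalSpace T] [CompactSpace T] [ChartedSpace H T] [IsManifold I r T]
    (ρ : FundamentalGroup (Leaf r p q x₀) (Leaf.base r p q x₀) →* diffGroup r I T)
    -- near the leaf, the foliation is the suspension
    (V : Set M) (hV : V ∈ 𝓝ˢ (leafSet r p q x₀))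
    (Φ : Suspension ((deckGroup π).subtype.comp θ.toMonoidHom)
      ((diffGroup r I T).subtype.comp ρ) → M)
    (hΦ : IsFoliatedIso r p q ((deckGroup π).subtype.comp θ.toMonoidHom)
      ((diffGroup r I T).subtype.comp ρ) Φ V) :
    Group.FG ρ.range ∧
    ∀ S : Set ρ.range, S.Finite → Subgroup.closure S = ⊤ →
      ∀ {ι : Type*} [Finite ι] (U : ι → Set M), IsGoodFoliatedCover r p q U →
        ∀ z ∈ V, ∀ P ∈ plaques r p q U z,
          GrowthBoundedBy (leafGrowth r p q U z P) (groupGrowth S) := by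
  have : LocallyPathConnectedSpace X := by
    let _ := hπ.isLocalHomeomorph.pullbackChartedSpace
    exact ChartedSpace.locallyPathConnectedSpace (Leaf r p q x₀) X
  obtain ⟨K, hK⟩ := hπ.exists_isCocompactDeckAction θ
  refine ⟨?_, fun S _ hS ι _ U hU z hz P hP => ?_⟩
  · have := hK.group_fg
    infer_instance
  · have h := hΦ.isSuspensionMap
    -- Factoring `ρ` through its image lets word length be measured there rather than in the
    -- fundamental group.
    exact IsSuspensionMap.growthBoundedBy (σ := ρ.rangeRestrict)
      (α := (diffGroup r I T).subtype.comp ρ.range.subtype) h hK hS hU hz hP
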